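/- For a prime $p$ and an integer $u$ with $\gcd(u,p)=1$, let the Fermat quotient $q_p(u)$ be the unique integer with $$q_p(u) \equiv \frac{u^{p-1}-1}{p} \pmod p, \qquad 0 \le q_p(u) \le p-1,$$ and for a positive integer $N$ let $$I_p(N) = \#\{q_p(n) : 1 \le n \le N,\ \gcd(n,p)=1\}.$$ Then for every prime $p$ and every integer $N$ with $2 \le N < p$, $$I_p(N) \ge (1+o(1))\,\frac{N^2}{p(\log N)^2},$$ where $o(1)$ denotes a quantity depending only on $p$ that tends to $0$ as $p \to \infty$; that is, the bound is uniform in $N$. -/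

import Mathlib

/-- The Fermat quotient `q_p(u)`: the representative in `{0, …, p - 1}` of the residue class of
`(u ^ (p - 1) - 1) / p` modulo `p`. For a prime `p` and `u` coprime to `p` the division by `p` is
exact, by Fermat's little theorem; it is only used for such `p` and `u`. -/
def fermatQuotient (p : ℕ) (u : ℤ) : ℤ :=
  ((u ^ (p - 1) - 1) / (p : ℤ)) % (p : ℤ)

/-- The image size `I_p(N) = #{q_p(n) : 1 ≤ n ≤ N, gcd(n, p) = 1}`. -/
def fermatQuotientImageSize (p N : ℕ) : ℕ :=
  (((Finset.Icc 1 N).filter (fun n => Nat.gcd n p = 1)).image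
    (fun n : ℕ => fermatQuotient p (n : ℤ))).card

/-! Let `k` be the number of odd primes up to `N`. If `u`, `v` share a Fermat quotient, then `u / v`
and `-u / v` are both `(p-1)`-th roots of unity mod `p ^ 2`. Distinct pairs give distinct classes,
and there are at most `p - 1` roots, so at most `p / 2` pairs collide. Cauchy-Schwarz gives `I ≥ k ^
2 / (k + p / 2)`. The sign saves a factor 2, so `k ≥ c * N / log N` with `c > 1 / √2` suffices for
large `p`, without the prime number theorem. Central binomials give only `c = log 2 < 1 / √2`, hence
Chebyshev's sharper quotient. -/

/-- The Chebyshev-type quotient `(12m)! m! / ((6m)! (4m)! (3m)!)` divides `lcm(1, …, 12m)`. -/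
theorem factorial_mul_factorial_dvd_mul_lcmUpto (m : ℕ) :
    (12 * m).factorial * m.factorial ∣
      (6 * m).factorial * (4 * m).factorial * (3 * m).factorial * Nat.lcmUpto (12 * m) := by
  have hf : ∀ n : ℕ, n.factorial ≠ 0 := Nat.factorial_ne_zero
  have hL := Nat.lcmUpto_ne_zero (12 * m)
  rw [← Nat.factorization_prime_le_iff_dvd (by simp [hf]) (by simp [hf, hL])]
  intro p hp
  have hlog : ∀ n ≤ 12 * m, n.factorial.factorization p =
      ∑ i ∈ Finset.Ico 1 (p.log (12 * m) + 1), n / p ^ i := fun n hn =>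
    Nat.factorization_factorial hp (Nat.lt_succ_of_le (Nat.log_mono_right hn))
  have hone : (Nat.lcmUpto (12 * m)).factorization p =
      ∑ i ∈ Finset.Ico 1 (p.log (12 * m) + 1), 1 := by simp [Nat.factorization_lcmUpto _ hp]
  rw [Nat.factorization_mul (hf _) (hf _), Nat.factorization_mul (by simp [hf]) hL,
    Nat.factorization_mul (by simp [hf]) (hf _), Nat.factorization_mul (hf _) (hf _)]
  simp only [Finsupp.add_apply]
  rw [hlog _ le_rfl, hlog m (by lia), hlog (6 * m) (by lia), hlog (4 * m) (by lia),
    hlog (3 * m) (by lia), hone]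
  simp only [← Finset.sum_add_distrib]
  refine Finset.sum_le_sum fun i _ => ?_
  have key : ∀ c d, c * d = 12 → 0 < c → d * m / p ^ i = 12 * m / p ^ i / c := by
    intro c d hcd hc
    rw [Nat.div_div_eq_div_mul, ← hcd, mul_comm (p ^ i), mul_assoc, Nat.mul_div_mul_left _ _ hc]
  have h2 := key 2 6 rfl (by norm_num)
  have h3 := key 3 4 rfl (by norm_num)
  have h4 := key 4 3 rfl (by norm_num)
  have h12 := key 12 1 rfl (by norm_num)
  rw [one_mul] at h12
  -- With `n = 12 * m / p ^ i`: `n + n/12 ≤ n/2 + n/3 + n/4 + 1`, which only depends on `n` mod 12.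
  rw [h2, h3, h4, h12]
  lia

theorem log_factorial_le {n : ℕ} (hn : n ≠ 0) :
    Real.log n.factorial ≤ n * Real.log n - n + Real.log (2 * n) / 2 + 1 := by
  obtain ⟨k, rfl⟩ := Nat.exists_eq_succ_of_ne_zero hn
  have h1 : Real.log (Stirling.stirlingSeq (k + 1)) ≤ 1 := by
    have h := Stirling.stirlingSeq'_antitone (Nat.zero_le k)
    simp only [Function.comp_apply, Nat.succ_eq_add_one, zero_add, Stirling.stirlingSeq_one] at h
    rw [Real.log_le_iff_le_exp (Stirling.stirlingSeq'_pos k)]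
    exact h.trans (div_le_self (Real.exp_pos 1).le (Real.one_le_sqrt.2 one_le_two))
  rw [Stirling.log_stirlingSeq_formula, Real.log_div (by positivity) (Real.exp_ne_zero 1),
    Real.log_exp] at h1
  simp only [Nat.succ_eq_add_one]
  linarith

theorem le_log_factorial {n : ℕ} (hn : n ≠ 0) :
    n * Real.log n - n ≤ Real.log n.factorial := by
  have h := Stirling.le_log_factorial_stirling hn
  have h1 : 0 ≤ Real.log n := Real.log_natCast_nonneg n
  have h2 : 0 ≤ Real.log (2 * Real.pi) := Real.log_nonneg (by linarith [Real.pi_gt_three])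
  linarith

/-- In the Stirling bounds the `m log m` and `m` terms cancel, leaving `10 log 2 + 3 log 3 > 9.9`
per `m`. -/
theorem le_psi_twelve_mul {m : ℕ} (hm : m ≠ 0) :
    99 / 10 * (m : ℝ) - 3 / 2 * Real.log (12 * m) - 3 ≤ Chebyshev.psi ((12 * m : ℕ) : ℝ) := by
  have hm0 : (0 : ℝ) < m := by positivity
  have hf : ∀ n : ℕ, (n.factorial : ℝ) ≠ 0 := fun n => by positivity
  have hL : (Nat.lcmUpto (12 * m) : ℝ) ≠ 0 := Nat.cast_ne_zero.2 (Nat.lcmUpto_ne_zero _)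
  have hle : ((12 * m).factorial : ℝ) * m.factorial ≤
      (6 * m).factorial * (4 * m).factorial * (3 * m).factorial * Nat.lcmUpto (12 * m) := by
    exact_mod_cast Nat.le_of_dvd
      (Nat.pos_of_ne_zero (by simp [Nat.factorial_ne_zero, Nat.lcmUpto_ne_zero]))
      (factorial_mul_factorial_dvd_mul_lcmUpto m)
  have hlog := Real.log_le_log (by positivity) hle
  rw [Real.log_mul (hf _) (hf _), Real.log_mul (by simp [hf]) hL,
    Real.log_mul (by simp [hf]) (hf _), Real.log_mul (hf _) (hf _)] at hlog
  rw [Chebyshev.psi_eq_log_lcmUpto]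
  have l12 := le_log_factorial (n := 12 * m) (by simpa)
  have l1 := le_log_factorial hm
  have u6 := log_factorial_le (n := 6 * m) (by simpa)
  have u4 := log_factorial_le (n := 4 * m) (by simpa)
  have u3 := log_factorial_le (n := 3 * m) (by simpa)
  have e12 : Real.log 12 = 2 * Real.log 2 + Real.log 3 := by
    rw [show (12 : ℝ) = 2 ^ 2 * 3 by norm_num, Real.log_mul (by norm_num) (by norm_num),
      Real.log_pow]; norm_num
  have e6 : Real.log 6 = Real.log 2 + Real.log 3 := by
    rw [show (6 : ℝ) = 2 * 3 by norm_num, Real.log_mul (by norm_num) (by norm_num)]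
  have e4 : Real.log 4 = 2 * Real.log 2 := by
    rw [show (4 : ℝ) = 2 ^ 2 by norm_num, Real.log_pow]; norm_num
  have g2 := Real.log_two_gt_d9
  have g3 : (1 : ℝ) ≤ Real.log 3 := by
    rw [Real.le_log_iff_exp_le (by norm_num)]; linarith [Real.exp_one_lt_d9]
  have d6 : Real.log (2 * ((6 * m : ℕ) : ℝ)) = Real.log (12 * m) := by push_cast; ring_nf
  have d4 : Real.log (2 * ((4 * m : ℕ) : ℝ)) ≤ Real.log (12 * m) :=
    Real.log_le_log (by positivity) (by push_cast; linarith)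
  have d3 : Real.log (2 * ((3 * m : ℕ) : ℝ)) ≤ Real.log (12 * m) :=
    Real.log_le_log (by positivity) (by push_cast; linarith)
  have expand : ∀ c : ℕ, c ≠ 0 → Real.log ((c * m : ℕ) : ℝ) = Real.log c + Real.log m :=
    fun c hc => by rw [Nat.cast_mul, Real.log_mul (by exact_mod_cast hc) hm0.ne']
  rw [expand 12 (by norm_num)] at l12
  rw [expand 6 (by norm_num)] at u6
  rw [expand 4 (by norm_num)] at u4
  rw [expand 3 (by norm_num)] at u3
  push_cast at l12 u6 u4 u3 d6 d4 d3
  rw [e12] at l12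
  rw [e6] at u6
  rw [e4] at u4
  have p2 : m * 0.69314718 ≤ m * Real.log 2 := by gcongr; linarith
  have p3 : (m : ℝ) * 1 ≤ m * Real.log 3 := by gcongr
  linarith

-- `9.9 / 12 = 0.825` leaves room above `4 / 5` for the error terms and the lost prime 2.
open Filter in
theorem eventually_le_card_primesLE_erase_two :
    ∀ᶠ N : ℕ in atTop, 4 / 5 * ((N : ℝ) / Real.log N) ≤ ((Nat.primesLE N).erase 2).card := by
  have ho : ∀ᶠ N : ℕ in atTop, Real.log (N : ℝ) ≤ 1 / 1000 * (N : ℝ) := by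
    have h := (Real.isLittleO_log_id_atTop.comp_tendsto
      (tendsto_natCast_atTop_atTop (R := ℝ))).def (c := 1 / 1000) (by norm_num)
    filter_upwards [h] with N hN
    simpa using (le_abs_self _).trans hN
  filter_upwards [ho, eventually_ge_atTop 10000] with N hlog hN
  have hm : N / 12 ≠ 0 := by lia
  have hm12 : 12 * (N / 12) ≤ N := Nat.mul_div_le N 12
  have hm12' : (N : ℝ) ≤ 12 * (N / 12 : ℕ) + 12 := by
    exact_mod_cast (show N ≤ 12 * (N / 12) + 12 by lia)
  have hNr : (10000 : ℝ) ≤ N := by exact_mod_cast hN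
  have hpos : 0 < Real.log N := Real.log_pos (by linarith)
  have hpsi := le_psi_twelve_mul hm
  have hmono : Chebyshev.psi ((12 * (N / 12) : ℕ) : ℝ) ≤ Chebyshev.psi N :=
    Chebyshev.psi_mono (by exact_mod_cast hm12)
  have hl : Real.log (12 * (N / 12 : ℕ)) ≤ Real.log N :=
    Real.log_le_log (by positivity) (by exact_mod_cast hm12)
  have hpi := Chebyshev.psi_le_primeCounting_mul_log N
  have hcard : (N.primeCounting : ℝ) ≤ ((Nat.primesLE N).erase 2).card + 1 := by
    rw [← Nat.primesLE_card_eq_primeCounting]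
    have := Finset.pred_card_le_card_erase (s := Nat.primesLE N) (a := 2)
    exact_mod_cast (show (Nat.primesLE N).card ≤ ((Nat.primesLE N).erase 2).card + 1 by lia)
  rw [← mul_div_assoc, div_le_iff₀ hpos]
  nlinarith

/-! ### Collisions of Fermat quotients -/

theorem pow_eq_pow_of_fermatQuotient_eq {p u v : ℕ} (hp : p.Prime) (hu : u.Coprime p)
    (hv : v.Coprime p) (h : fermatQuotient p u = fermatQuotient p v) :
    (u : ZMod (p ^ 2)) ^ (p - 1) = (v : ZMod (p ^ 2)) ^ (p - 1) := by
  have hp0 : (p : ℤ) ≠ 0 := by exact_mod_cast hp.ne_zero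
  have fermat : ∀ w : ℕ, w.Coprime p → (p : ℤ) ∣ (w : ℤ) ^ (p - 1) - 1 := fun w hw =>
    (Int.ModEq.pow_card_sub_one_eq_one hp (by exact_mod_cast hw)).symm.dvd
  obtain ⟨a, ha⟩ := fermat u hu
  obtain ⟨b, hb⟩ := fermat v hv
  simp only [fermatQuotient, ha, hb, Int.mul_ediv_cancel_left _ hp0] at h
  obtain ⟨c, hc⟩ := Int.ModEq.dvd (show b ≡ a [ZMOD p] from h.symm)
  have hdvd : ((p ^ 2 : ℕ) : ℤ) ∣ (u : ℤ) ^ (p - 1) - (v : ℤ) ^ (p - 1) :=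
    ⟨c, by push_cast; linear_combination ha - hb + (p : ℤ) * hc⟩
  have := (ZMod.intCast_eq_intCast_iff_dvd_sub _ _ _).2 hdvd
  push_cast at this
  exact this.symm

/-- Distinct odd primes `u, v < p` are recovered, together with the sign, from the class
`± u / v` modulo `p ^ 2`. -/
theorem prime_ratio_injective {p u v u' v' : ℕ} (hp : Odd p) (s s' : Bool)
    (hu : u.Prime) (hv : v.Prime) (hu' : u'.Prime) (hv' : v'.Prime)
    (hu2 : u ≠ 2) (hv2 : v ≠ 2) (hu2' : u' ≠ 2) (hv2' : v' ≠ 2)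
    (hup : u < p) (hvp : v < p) (hup' : u' < p) (hvp' : v' < p) (huv : u ≠ v)
    (h : (if s then (1 : ZMod (p ^ 2)) else -1) * (u * v') =
      (if s' then (1 : ZMod (p ^ 2)) else -1) * (u' * v)) :
    u = u' ∧ v = v' ∧ s = s' := by
  have b1 : u * v' < p ^ 2 := by rw [sq]; gcongr
  have b2 : u' * v < p ^ 2 := by rw [sq]; gcongr
  have same : (u : ZMod (p ^ 2)) * v' = u' * v → u = u' ∧ v = v' := by
    intro h
    have h1 : ((u * v' : ℕ) : ZMod (p ^ 2)) = ((u' * v : ℕ) : ZMod (p ^ 2)) := by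
      push_cast; exact h
    have h2 : u * v' = u' * v :=
      Nat.ModEq.eq_of_lt_of_lt ((ZMod.natCast_eq_natCast_iff _ _ _).1 h1) b1 b2
    have h3 : u = u' := by
      rcases hu.dvd_mul.1 (Dvd.intro _ h2 : u ∣ u' * v) with h | h
      · exact (Nat.prime_dvd_prime_iff_eq hu hu').1 h
      · exact absurd ((Nat.prime_dvd_prime_iff_eq hu hv).1 h) huv
    subst h3
    exact ⟨rfl, (Nat.eq_of_mul_eq_mul_left hu.pos h2).symm⟩
  -- The sum is below `2 * p ^ 2`, so it would equal the odd number `p ^ 2`; but it is even, all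
  -- four primes being odd.
  have opp : (u : ZMod (p ^ 2)) * v' + u' * v ≠ 0 := by
    intro h
    have h1 : ((u * v' + u' * v : ℕ) : ZMod (p ^ 2)) = 0 := by push_cast; exact h
    obtain ⟨k, hk⟩ := (ZMod.natCast_eq_zero_iff _ _).1 h1
    have hodd : ∀ {w : ℕ}, w.Prime → w ≠ 2 → Odd w := fun hw => hw.odd_of_ne_two
    have he : Even (u * v' + u' * v) :=
      ((hodd hu hu2).mul (hodd hv' hv2')).add_odd ((hodd hu' hu2').mul (hodd hv hv2))
    have hpos : 0 < u * v' := Nat.mul_pos hu.pos hv'.pos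
    have hk0 : k ≠ 0 := by rintro rfl; lia
    have hk2 : k < 2 := by nlinarith
    obtain rfl : k = 1 := by lia
    rw [hk, mul_one] at he
    exact (Nat.not_even_iff_odd.2 hp.pow) he
  cases s <;> cases s' <;> simp only [Bool.false_eq_true, if_true, if_false] at h
  · obtain ⟨h1, h2⟩ := same (by linear_combination -h)
    exact ⟨h1, h2, rfl⟩
  · exact absurd (by linear_combination -h) opp
  · exact absurd (by linear_combination h) opp
  · obtain ⟨h1, h2⟩ := same (by linear_combination h)
    exact ⟨h1, h2, rfl⟩

/-- Among the odd primes up to `N < p`, at most `(p - 1) / 2` ordered pairs of distinct elements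
share their Fermat quotient. -/
theorem two_mul_card_offDiag_fermatQuotient_eq_le {p N : ℕ} (hp : p.Prime) (hp2 : p ≠ 2)
    (hN : N < p) :
    2 * (((Nat.primesLE N).erase 2).offDiag.filter
      fun x => fermatQuotient p x.1 = fermatQuotient p x.2).card ≤ p - 1 := by
  classical
  set P := ((Nat.primesLE N).erase 2).offDiag.filter
      fun x => fermatQuotient p x.1 = fermatQuotient p x.2 with hP
  have hpodd : Odd p := hp.odd_of_ne_two hp2
  have : NeZero (p ^ 2) := ⟨pow_ne_zero _ hp.ne_zero⟩
  have := ZMod.isCyclic_units_of_prime_pow p hp hp2 2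
  have hcop : ∀ {u : ℕ}, u.Prime → u < p → u.Coprime p := fun hu hlt =>
    (Nat.coprime_primes hu hp).2 hlt.ne
  have hmem : ∀ x ∈ P, (x.1.Prime ∧ x.1 ≠ 2 ∧ x.1 < p) ∧ (x.2.Prime ∧ x.2 ≠ 2 ∧ x.2 < p) ∧
      x.1 ≠ x.2 ∧ fermatQuotient p x.1 = fermatQuotient p x.2 := by
    intro x hx
    simp only [hP, Finset.mem_filter, Finset.mem_offDiag, Finset.mem_erase,
      Nat.mem_primesLE] at hx
    obtain ⟨⟨⟨a, b, c⟩, ⟨d, e, f⟩, g⟩, h⟩ := hx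
    exact ⟨⟨c, a, by lia⟩, ⟨f, d, by lia⟩, g, h⟩
  -- The default `1` is never reached at primes below `p`.
  let toUnit : ℕ → (ZMod (p ^ 2))ˣ := fun u =>
    if h : u.Coprime (p ^ 2) then ZMod.unitOfCoprime u h else 1
  have htoUnit : ∀ {u : ℕ}, u.Prime → u < p → (toUnit u : ZMod (p ^ 2)) = u := by
    intro u hu hlt
    have : u.Coprime (p ^ 2) := (hcop hu hlt).pow_right 2
    simp only [toUnit, dif_pos this, ZMod.coe_unitOfCoprime]
  let sign : Bool → (ZMod (p ^ 2))ˣ := fun s => if s then 1 else -1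
  let f : (ℕ × ℕ) × Bool → (ZMod (p ^ 2))ˣ := fun y => sign y.2 * (toUnit y.1.1 / toUnit y.1.2)
  have hmaps : ∀ y ∈ P ×ˢ (Finset.univ : Finset Bool),
      f y ∈ (Finset.univ.filter fun w : (ZMod (p ^ 2))ˣ => w ^ (p - 1) = 1) := by
    rintro ⟨⟨u, v⟩, s⟩ hy
    obtain ⟨⟨hu, -, hup⟩, ⟨hv, -, hvp⟩, -, hq⟩ := hmem (u, v) (Finset.mem_product.1 hy).1
    have hs : sign s ^ (p - 1) = 1 := by
      have : Even (p - 1) := hp.even_sub_one hp2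
      cases s <;> simp [sign, this.neg_one_pow]
    have hpow : toUnit u ^ (p - 1) = toUnit v ^ (p - 1) := by
      ext
      simp only [Units.val_pow_eq_pow_val]
      rw [htoUnit hu hup, htoUnit hv hvp]
      exact pow_eq_pow_of_fermatQuotient_eq hp (hcop hu hup) (hcop hv hvp) hq
    simp only [Finset.mem_filter, Finset.mem_univ, true_and, f]
    rw [mul_pow, div_pow, hs, hpow, div_self', one_mul]
  have hinj : Set.InjOn f (P ×ˢ (Finset.univ : Finset Bool) : Finset _) := by
    rintro ⟨⟨u, v⟩, s⟩ hy ⟨⟨u', v'⟩, s'⟩ hy' h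
    obtain ⟨⟨hu, hu2, hup⟩, ⟨hv, hv2, hvp⟩, huv, -⟩ :=
      hmem (u, v) (Finset.mem_product.1 (Finset.mem_coe.1 hy)).1
    obtain ⟨⟨hu', hu2', hup'⟩, ⟨hv', hv2', hvp'⟩, -, -⟩ :=
      hmem (u', v') (Finset.mem_product.1 (Finset.mem_coe.1 hy')).1
    simp only at hu hu2 hup hv hv2 hvp huv hu' hu2' hup' hv' hv2' hvp'
    have h1 : sign s * (toUnit u * toUnit v') = sign s' * (toUnit u' * toUnit v) := by
      simp only [f] at h
      rw [← mul_div_assoc, ← mul_div_assoc, div_eq_div_iff_mul_eq_mul] at h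
      rw [← mul_assoc, ← mul_assoc, h]
    have h2 := congrArg Units.val h1
    have hsv : ∀ t, ((sign t : (ZMod (p ^ 2))ˣ) : ZMod (p ^ 2)) = if t then 1 else -1 := by
      intro t; cases t <;> simp [sign]
    simp only [Units.val_mul] at h2
    rw [htoUnit hu hup, htoUnit hv hvp, htoUnit hu' hup', htoUnit hv' hvp', hsv, hsv] at h2
    obtain ⟨rfl, rfl, rfl⟩ := prime_ratio_injective hpodd s s' hu hv hu' hv' hu2 hv2 hu2' hv2'
      hup hvp hup' hvp' huv h2
    rfl
  have hcard := (Finset.card_le_card_of_injOn f hmaps hinj).trans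
    (IsCyclic.card_pow_eq_one_le (Nat.sub_pos_of_lt hp.one_lt))
  rw [Finset.card_product, Finset.card_univ, Fintype.card_bool] at hcard
  lia

/-! ### From collisions to image size -/

/-- Cauchy-Schwarz on the fibre sizes of `f`; the diagonal contributes `s.card`. -/
theorem sq_card_le_card_image_mul {α β : Type*} [DecidableEq α] [DecidableEq β] (s : Finset α)
    (f : α → β) :
    s.card ^ 2 ≤ (s.image f).card * (s.card + (s.offDiag.filter fun x => f x.1 = f x.2).card) := by
  have h1 : s.card + (s.offDiag.filter fun x => f x.1 = f x.2).card =
      ((s ×ˢ s).filter fun x => f x.1 = f x.2).card := by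
    rw [← Finset.diag_union_offDiag, Finset.filter_union, Finset.card_union_of_disjoint
      (Finset.disjoint_filter_filter (Finset.disjoint_diag_offDiag s)),
      Finset.filter_true_of_mem (s := s.diag), Finset.diag_card]
    intro x hx
    rw [(Finset.mem_diag.1 hx).2]
  have h2 : ((s ×ˢ s).filter fun x => f x.1 = f x.2).card =
      ∑ b ∈ s.image f, (s.filter fun a => f a = b).card ^ 2 := by
    rw [Finset.card_eq_sum_card_fiberwise (f := fun x => f x.1) (t := s.image f)]
    · refine Finset.sum_congr rfl fun b _ => ?_
      rw [sq, ← Finset.card_product]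
      congr 1
      ext x
      simp only [Finset.mem_filter, Finset.mem_product]
      grind
    · intro x hx
      simp only [Finset.coe_filter, Set.mem_ofPred_eq, Finset.mem_product] at hx
      exact Finset.mem_coe.2 (Finset.mem_image_of_mem f hx.1.1)
  rw [h1, h2]
  conv_lhs => rw [Finset.card_eq_sum_card_image f s]
  exact_mod_cast sq_sum_le_card_mul_sum_sq

theorem sq_card_primesLE_erase_two_le {p N : ℕ} (hp : p.Prime) (hp2 : p ≠ 2) (hN : N < p) :
    (((Nat.primesLE N).erase 2).card : ℝ) ^ 2 ≤
      fermatQuotientImageSize p N * (((Nat.primesLE N).erase 2).card + p / 2) := by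
  set S := (Nat.primesLE N).erase 2 with hS
  have h1 := sq_card_le_card_image_mul S (fun n : ℕ => fermatQuotient p (n : ℤ))
  have h2 : (S.image fun n : ℕ => fermatQuotient p (n : ℤ)).card ≤
      fermatQuotientImageSize p N := by
    refine Finset.card_le_card (Finset.image_subset_image fun n hn => ?_)
    simp only [hS, Finset.mem_erase, Nat.mem_primesLE] at hn
    simp only [Finset.mem_filter, Finset.mem_Icc]
    exact ⟨⟨hn.2.2.one_le, hn.2.1⟩, (Nat.coprime_primes hn.2.2 hp).2 (by lia)⟩
  have h3 := two_mul_card_offDiag_fermatQuotient_eq_le hp hp2 hN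
  rw [← hS] at h3
  have h3' : ((S.offDiag.filter fun x =>
      fermatQuotient p (x.1 : ℤ) = fermatQuotient p (x.2 : ℤ)).card : ℝ) ≤ p / 2 := by
    rw [le_div_iff₀ two_pos]
    exact_mod_cast (by lia : _ * 2 ≤ p)
  have h1' := (Nat.cast_le (α := ℝ)).2 h1
  push_cast at h1'
  refine h1'.trans ?_
  gcongr

theorem one_le_fermatQuotientImageSize {p N : ℕ} (hN : 1 ≤ N) :
    1 ≤ fermatQuotientImageSize p N :=
  Finset.card_pos.2 (Finset.Nonempty.image ⟨1, by simp [hN]⟩ _)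

/-- With `x = N / log N`, `x ≤ 5k/4` and `x ≤ p/8` give `x ^ 2 * (k + p/2) ≤ (5/32 + 25/32) * p * k
^ 2`. -/
theorem le_fermatQuotientImageSize_of_le_card {p N : ℕ} (hp : p.Prime) (hp2 : p ≠ 2) (hN : N < p)
    (hlog : 8 ≤ Real.log N)
    (hcard : 4 / 5 * ((N : ℝ) / Real.log N) ≤ ((Nat.primesLE N).erase 2).card) :
    (N : ℝ) ^ 2 / (p * Real.log N ^ 2) ≤ fermatQuotientImageSize p N := by
  have hpair := sq_card_primesLE_erase_two_le hp hp2 hN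
  set k : ℝ := (((Nat.primesLE N).erase 2).card : ℝ)
  set I : ℝ := (fermatQuotientImageSize p N : ℝ)
  have hp0 : (0 : ℝ) < p := by exact_mod_cast hp.pos
  have hNp : (N : ℝ) ≤ p := by exact_mod_cast hN.le
  have hx0 : 0 ≤ (N : ℝ) / Real.log N := by positivity
  have hx8 : (N : ℝ) / Real.log N ≤ p / 8 := by gcongr
  have heq : (N : ℝ) ^ 2 / (p * Real.log N ^ 2) = (N / Real.log N) ^ 2 / p := by
    rw [div_pow, div_div, mul_comm (p : ℝ)]
  rw [heq]
  generalize (N : ℝ) / Real.log N = x at *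
  have hk : 0 ≤ k := by positivity
  have hquot : k ^ 2 / (k + p / 2) ≤ I := (div_le_iff₀ (by positivity)).2 hpair
  refine le_trans ?_ hquot
  rw [div_le_div_iff₀ hp0 (by positivity)]
  have h1 : x * k ≤ 5 / 4 * k ^ 2 := by nlinarith
  have h2 : x ^ 2 ≤ 25 / 16 * k ^ 2 := by nlinarith
  have h3 : x * (x * k) ≤ p / 8 * (5 / 4 * k ^ 2) := by gcongr
  nlinarith

open Filter in
theorem eventually_forall_le_fermatQuotientImageSize :
    ∀ᶠ p : ℕ in atTop, p.Prime → ∀ N : ℕ, 2 ≤ N → N < p →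
      (N : ℝ) ^ 2 / (p * Real.log N ^ 2) ≤ fermatQuotientImageSize p N := by
  have hlog : ∀ᶠ N : ℕ in atTop, (8 : ℝ) ≤ Real.log N :=
    (Real.tendsto_log_atTop.comp tendsto_natCast_atTop_atTop).eventually_ge_atTop 8
  obtain ⟨N₀, hN₀⟩ := eventually_atTop.1 (hlog.and eventually_le_card_primesLE_erase_two)
  filter_upwards [eventually_gt_atTop 2, eventually_ge_atTop (4 * N₀ ^ 2)]
    with p hp2 hpN hp N hN hNp
  rcases le_or_gt N₀ N with h | h
  · exact le_fermatQuotientImageSize_of_le_card hp hp2.ne' hNp (hN₀ N h).1 (hN₀ N h).2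
  -- For bounded `N` the target is at most `4 * N ^ 2 / p ≤ 1`.
  · have hone : (1 : ℝ) ≤ fermatQuotientImageSize p N := by
      exact_mod_cast one_le_fermatQuotientImageSize (by lia : 1 ≤ N)
    refine le_trans ?_ hone
    have hp0 : (0 : ℝ) < p := by exact_mod_cast hp.pos
    have hl : (1 / 2 : ℝ) ≤ Real.log N := by
      have : Real.log 2 ≤ Real.log N := Real.log_le_log two_pos (by exact_mod_cast hN)
      linarith [Real.log_two_gt_d9]
    have hNN : (4 : ℝ) * N ^ 2 ≤ p := by
      have : 4 * N ^ 2 ≤ 4 * N₀ ^ 2 := by gcongr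
      exact_mod_cast this.trans hpN
    rw [div_le_one (by positivity)]
    have : (p : ℝ) * (1 / 2) ^ 2 ≤ p * Real.log N ^ 2 := by gcongr
    linarith

theorem theorem11 :
    ∃ δ : ℕ → ℝ, Filter.Tendsto δ Filter.atTop (nhds 0) ∧
      ∀ p : ℕ, p.Prime → ∀ N : ℕ, 2 ≤ N → N < p →
        (1 + δ p) * ((N : ℝ) ^ 2 / ((p : ℝ) * (Real.log (N : ℝ)) ^ 2))
          ≤ (fermatQuotientImageSize p N : ℝ) := by
  obtain ⟨P, hP⟩ := Filter.eventually_atTop.1 eventually_forall_le_fermatQuotientImageSize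
  -- The value `-1` makes the bound trivial for the finitely many small `p`.
  refine ⟨fun p => if P ≤ p then 0 else -1, ?_, fun p hp N hN hNp => ?_⟩
  · refine tendsto_const_nhds.congr' ?_
    filter_upwards [Filter.eventually_ge_atTop P] with p hp
    rw [if_pos hp]
  · by_cases h : P ≤ p
    · simpa [h] using hP p h hp N hN hNp
    · simp [h]
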